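/- Let $C$ be a CSS code, i.e. a complex $\mathbb F_2^{Z}\xrightarrow{H_Z^T}\mathbb F_2^{Q}\xrightarrow{H_X}\mathbb F_2^{X}$ with finite sets $X,Z$ of checks and $Q$ of qubits, and fix a $\mathbb Z$-lift of it: a complex $\mathbb Z^{Z}\xrightarrow{\widetilde H_Z^T}\mathbb Z^{Q}\xrightarrow{\widetilde H_X}\mathbb Z^{X}$ that reduces to $C$ modulo $2$. The lifted Tanner graph $\widetilde T$ has vertex set $X\sqcup Q$ and $|(\widetilde H_X)_{x,q}|$ edges between $x$ and $q$. For $z\in Z$, $\widetilde T_z\subseteq\widetilde T$ consists of the qubits in the support of row $z$ of $\widetilde H_Z$, all edges of $\widetilde T$ at these qubits, and their ends. Replace each qubit $q$ of $\widetilde T_z$ by $|(\widetilde H_Z)_{z,q}|$ copies, each with a copy of every edge $[x,q]$ at $q$, of sign $\mathrm{sgn}(\widetilde H_Z)_{z,q}\,\mathrm{sgn}(\widetilde H_X)_{x,q}$; pair oppositely signed edges at every $X$-vertex, and replace the $X$-vertices by one vertex of degree two for each pair. A graph so obtained is denoted $G_z$; it projects onto $\widetilde T_z$. A cellular realization $L\in\mathcal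 L(C)$ (for the fixed $\mathbb Z$-lift) is a finite $5$-dimensional cell complex of the following form. (1) Its $1$-skeleton $L^1$ consists of $\widetilde T$ and, for every $z\in Z$, finitely many $Z$-type edges of $z$; these join vertices of $\widetilde T_z$ and are projections of edges that connect the components of a choice of $G_z$. Write $\Gamma_z$ for the union of $\widetilde T_z$ and the $Z$-type edges of $z$. (2) For every $z\in Z$ there are finitely many $2$-cells, attached along closed edge paths of $\Gamma_z$, such that $\Gamma_z$ together with these $2$-cells is a simply connected complex $\overline T_z$ (non-empty, so every row of $\widetilde H_Z$ is non-zero). (3) For every $x\in X$ there is one $3$-cell, attached to the vertex $x$ by the constant map. (4) For every $q\in Q$ there is one $4$-cell. It is attached through the star of $q$ in $\widetilde T$ (the edges at $q$, with separate outer ends) with a $3$-sphere at the outer end of each edge, where a sphere at an edge $[x,q]$ is mapped to the $3$-cell of $x$ and the incidence number of the $4$-cell with this sphere is $\mathrm{sgn}(\widetilde H_X)_{x,q}$. (5) For every $z\in Z$ there is one $5$-cell. It is attached to the union of $\overline T_z$, the $3$-cells of the $X$-vertices of $\widetilde T_z$ and the $4$-cells of the qubits of $\widetilde T_z$, with incidence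 number $(\widetilde H_Z)_{z,q}$ with the $4$-cell of $q$. **Lemma.** Let $L_1,L_2\in\mathcal L(C)$ be two cellular realizations with identical $1$-skeletons (with the same $Z$-type edges for every $z\in Z$). Then $\pi_1(L_1)\cong\pi_1(L_2)$, whatever $2$-cells were chosen for the simply connected complexes $\overline T_{z}$. Precisely, $\pi_1(L_1,p)\cong\pi_1(L_2,p)$ for every point $p$ of the common $1$-skeleton; and if this $1$-skeleton is path connected, then $\pi_1(L_1,a_1)\cong\pi_1(L_2,a_2)$ for all base points $a_1\in L_1$, $a_2\in L_2$. -/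

import Mathlib

noncomputable section

namespace CSSRealization

open Metric

/-! ### Attaching cells -/

/-- The `n`-sphere, as the unit sphere of `ℝⁿ⁺¹`. -/
abbrev Sph (n : ℕ) : Type := sphere (0 : EuclideanSpace ℝ (Fin (n + 1))) 1

/-- The closed `n`-disk, as the unit ball of `ℝⁿ`. -/
abbrev Disk (n : ℕ) : Type := closedBall (0 : EuclideanSpace ℝ (Fin n)) 1

/-- The inclusion of the boundary sphere in the disk. -/
def Sph.toDisk {n : ℕ} (s : Sph n) : Disk (n + 1) := ⟨s.1, sphere_subset_closedBall s.2⟩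

universe u v w

/-- The gluing relation of a family of `(n+1)`-cells, attached to `A` along maps `φ i : Sⁿ → A`. -/
inductive AttachRel {A : Type u} [TopologicalSpace A] {ι : Type v} (n : ℕ)
    (φ : ι → C(Sph n, A)) : A ⊕ (Σ _ : ι, Disk (n + 1)) → A ⊕ (Σ _ : ι, Disk (n + 1)) → Prop
  | glue (i : ι) (s : Sph n) : AttachRel n φ (Sum.inr ⟨i, s.toDisk⟩) (Sum.inl (φ i s))

/-- The space obtained from `A` by attaching one `(n+1)`-cell along `φ i : Sⁿ → A` for every `i`,
with the quotient topology. -/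
def Attach {A : Type u} [TopologicalSpace A] {ι : Type v} (n : ℕ) (φ : ι → C(Sph n, A)) :
    Type (max u v) :=
  Quot (AttachRel n φ)

namespace Attach

variable {A : Type u} [TopologicalSpace A] {ι : Type v} {n : ℕ} (φ : ι → C(Sph n, A))

instance : TopologicalSpace (Attach n φ) :=
  inferInstanceAs (TopologicalSpace (Quot (AttachRel n φ)))

/-- The inclusion of `A`. -/
def base : C(A, Attach n φ) :=
  ⟨fun a => Quot.mk _ (Sum.inl a), continuous_quot_mk.comp continuous_inl⟩

/-- The characteristic map of the cell `i`. -/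
def cell (i : ι) : C(Disk (n + 1), Attach n φ) :=
  ⟨fun d => Quot.mk _ (Sum.inr ⟨i, d⟩),
    continuous_quot_mk.comp (continuous_inr.comp continuous_sigmaMk)⟩

theorem cell_toDisk (i : ι) (s : Sph n) : cell φ i s.toDisk = base φ (φ i s) :=
  Quot.sound (AttachRel.glue i s)

variable {φ}

/-- Maps out of `Attach n φ`. -/
def desc {B : Type w} [TopologicalSpace B] (f : C(A, B)) (g : ι → C(Disk (n + 1), B))
    (h : ∀ i s, g i s.toDisk = f (φ i s)) : C(Attach n φ, B) where
  toFun := Quot.lift (Sum.elim f fun p => g p.1 p.2) (by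
    rintro _ _ ⟨i, s⟩
    exact h i s)
  continuous_toFun := continuous_quot_lift _
    (f.continuous.sumElim (continuous_sigma fun i => (g i).continuous))

theorem induction_on {P : Attach n φ → Prop} (x : Attach n φ) (hb : ∀ a, P (base φ a))
    (hc : ∀ i d, P (cell φ i d)) : P x := by
  induction x using Quot.ind with
  | mk y =>
    rcases y with a | ⟨i, d⟩
    · exact hb a
    · exact hc i d

/-- The map that extends `f : A → B` by sending the cell `i` identically to the cell `g i`. -/
def map {B : Type*} [TopologicalSpace B] {κ : Type*} {ψ : κ → C(Sph n, B)}
    (f : C(A, B)) (g : ι → κ) (h : ∀ i s, ψ (g i) s = f (φ i s)) :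
    C(Attach n φ, Attach n ψ) :=
  desc ((base ψ).comp f) (fun i => cell ψ (g i)) (fun i s => by
    rw [cell_toDisk, h]
    rfl)

end Attach

/-! ### Degrees and incidence numbers -/

/-- The map `Dⁿ⁺¹ → Sⁿ⁺¹`, `v ↦ (2|v|² - 1, 2√(1-|v|²) v)`. It collapses the boundary of the disk to
the pole `(1, 0)`, and is a homeomorphism from the open disk to the complement of that pole. -/
def pinchDisk (n : ℕ) : C(Disk (n + 1), Sph (n + 1)) where
  toFun v := ⟨WithLp.toLp 2 (Fin.cons (2 * ‖v.1‖ ^ 2 - 1)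
      (fun i => 2 * Real.sqrt (1 - ‖v.1‖ ^ 2) * v.1 i)), by
    have hv : ‖v.1‖ ≤ 1 := mem_closedBall_zero_iff.mp v.2
    have h0 : 0 ≤ 1 - ‖v.1‖ ^ 2 := by nlinarith [norm_nonneg v.1]
    rw [mem_sphere_zero_iff_norm, EuclideanSpace.norm_eq, Real.sqrt_eq_one, Fin.sum_univ_succ]
    simp only [Fin.cons_zero, Fin.cons_succ, Real.norm_eq_abs, sq_abs, mul_pow,
      ← Finset.mul_sum, Real.sq_sqrt h0]
    rw [← EuclideanSpace.real_norm_sq_eq]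
    ring⟩
  continuous_toFun := by
    refine Continuous.subtype_mk ((PiLp.continuous_toLp 2 _).comp (continuous_pi fun i => ?_)) _
    refine Fin.cases ?_ (fun j => ?_) i
    · simp only [Fin.cons_zero]
      fun_prop
    · simp only [Fin.cons_succ]
      fun_prop

/-- The common image of the boundary points of the disk under `pinchDisk`. -/
def pole (n : ℕ) : Sph (n + 1) :=
  ⟨EuclideanSpace.single 0 1, by simp⟩

theorem pinchDisk_toDisk {n : ℕ} (s : Sph n) : pinchDisk n s.toDisk = pole n := by
  have hs : ‖s.1‖ = 1 := mem_sphere_zero_iff_norm.mp s.2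
  apply Subtype.ext
  ext i
  refine Fin.cases ?_ (fun j => ?_) i
  · simp [pinchDisk, pole, Sph.toDisk, hs]
    norm_num
  · simp [pinchDisk, pole, Sph.toDisk, hs]

open Classical in
/-- The map `A ∪ cells → Sⁿ⁺¹` that collapses everything outside the open cell `i`. -/
def Attach.collapse {A : Type u} [TopologicalSpace A] {ι : Type v} {n : ℕ}
    (φ : ι → C(Sph n, A)) (i : ι) : C(Attach n φ, Sph (n + 1)) :=
  Attach.desc (ContinuousMap.const A (pole n))
    (fun j => if j = i then pinchDisk n else ContinuousMap.const _ (pole n)) (fun j s => by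
      split_ifs
      · exact pinchDisk_toDisk s
      · rfl)

/-- `f : Sⁿ → Sⁿ` (with `n ≥ 1`) has degree `d`: it acts on `Hₙ(Sⁿ; ℤ)` as multiplication by `d`. -/
def HasDegree {n : ℕ} (f : C(Sph n, Sph n)) (d : ℤ) : Prop :=
  ((AlgebraicTopology.singularHomologyFunctor (ModuleCat.{0} ℤ) n).obj (ModuleCat.of ℤ ℤ)).map
    (TopCat.ofHom f) = d • CategoryTheory.CategoryStruct.id _

/-- The cell attached along `α : Sⁿ⁺¹ → A ∪ (n+1)-cells` has incidence number `d` with the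
`(n+1)`-cell `i`. -/
def HasIncidence {A : Type u} [TopologicalSpace A] {ι : Type v} {n : ℕ}
    (φ : ι → C(Sph n, A)) (α : C(Sph (n + 1), Attach n φ)) (i : ι) (d : ℤ) : Prop :=
  HasDegree ((Attach.collapse φ i).comp α) d

/-! ### Graphs -/

/-- A multigraph (loops and multiple edges allowed), with a reference orientation of its edges. -/
structure MGraph where
  /-- vertices -/
  V : Type u
  /-- edges -/
  E : Type v
  src : E → V
  tgt : E → V

namespace MGraph

/-- The vertices as a discrete space. -/
def Vert (Γ : MGraph.{u, v}) : Type u := Γ.V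

instance (Γ : MGraph.{u, v}) : TopologicalSpace Γ.Vert := ⊥

instance (Γ : MGraph.{u, v}) : DiscreteTopology Γ.Vert := ⟨rfl⟩

open Classical in
/-- The attaching map of an edge: `-1 ↦ src`, `1 ↦ tgt`. -/
def ends (Γ : MGraph.{u, v}) (e : Γ.E) : C(Sph 0, Γ.Vert) where
  toFun s := if s.1 0 < 0 then Γ.src e else Γ.tgt e
  continuous_toFun := by
    have hc : Continuous fun s : Sph 0 => s.1 0 := by fun_prop
    have hne : ∀ s : Sph 0, s.1 0 ≠ 0 := by
      intro s h
      have hs : ‖s.1‖ = 1 := mem_sphere_zero_iff_norm.mp s.2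
      rw [EuclideanSpace.norm_eq] at hs
      simp [h] at hs
    have hcl : IsClopen {s : Sph 0 | s.1 0 < 0} := by
      refine ⟨?_, isOpen_lt hc continuous_const⟩
      have : {s : Sph 0 | s.1 0 < 0} = {s : Sph 0 | s.1 0 ≤ 0} := by
        ext s
        exact ⟨fun h => le_of_lt (show s.1 0 < 0 from h), fun h => lt_of_le_of_ne h (hne s)⟩
      rw [this]
      exact isClosed_le hc continuous_const
    refine Continuous.if (fun a ha => ?_) continuous_const continuous_const
    rw [hcl.frontier_eq] at ha
    exact ha.elim

/-- The geometric realization of a graph, a one-dimensional cell complex. -/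
abbrev Space (Γ : MGraph.{u, v}) : Type (max u v) := Attach 0 Γ.ends

/-- A vertex as a point of the geometric realization. -/
def vertex (Γ : MGraph.{u, v}) (a : Γ.V) : Γ.Space := Attach.base Γ.ends a

/-- The vertices `a` and `b` lie in the same component. -/
def Joined (Γ : MGraph.{u, v}) (a b : Γ.V) : Prop :=
  Relation.EqvGen (fun a b => ∃ e, Γ.src e = a ∧ Γ.tgt e = b) a b

/-- Morphisms of graphs (preserving the reference orientations). -/
structure Hom (Γ : MGraph) (Δ : MGraph) where
  onV : Γ.V → Δ.V
  onE : Γ.E → Δ.E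
  src_onE : ∀ e, Δ.src (onE e) = onV (Γ.src e)
  tgt_onE : ∀ e, Δ.tgt (onE e) = onV (Γ.tgt e)

/-- The map of geometric realizations induced by a morphism of graphs. -/
def Hom.map {Γ Δ : MGraph} (f : Hom Γ Δ) : C(Γ.Space, Δ.Space) :=
  Attach.map (φ := Γ.ends) (ψ := Δ.ends) ⟨f.onV, continuous_of_discreteTopology⟩ f.onE
    (fun e s => by
      simp only [ends, ContinuousMap.coe_mk, f.src_onE, f.tgt_onE]
      exact (apply_ite f.onV _ _ _).symm)

/-- An oriented edge: `(e, true)` runs from `src e` to `tgt e`, `(e, false)` backwards. -/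
abbrev Dart (Γ : MGraph.{u, v}) : Type v := Γ.E × Bool

def dartSrc (Γ : MGraph.{u, v}) (d : Γ.Dart) : Γ.V := if d.2 then Γ.src d.1 else Γ.tgt d.1

def dartTgt (Γ : MGraph.{u, v}) (d : Γ.Dart) : Γ.V := if d.2 then Γ.tgt d.1 else Γ.src d.1

/-- The point of the disk `D¹ = [-1, 1]` with coordinate `2 t - 1`, for `t ∈ [0, 1]`. -/
def diskPt (t : unitInterval) : Disk 1 :=
  ⟨WithLp.toLp 2 fun _ => 2 * (t : ℝ) - 1, by
    rw [mem_closedBall_zero_iff, EuclideanSpace.norm_eq, Real.sqrt_le_one]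
    simp only [Finset.univ_unique, Finset.sum_const, Finset.card_singleton, one_smul,
      Real.norm_eq_abs, sq_abs]
    nlinarith [t.2.1, t.2.2]⟩

/-- The point at time `t ∈ [0, 1]` on an oriented edge. -/
def dartPt (Γ : MGraph.{u, v}) (d : Γ.Dart) (t : unitInterval) : Γ.Space :=
  Attach.cell Γ.ends d.1 (diskPt (if d.2 then t else unitInterval.symm t))

end MGraph

/-- The point of the circle at angle `2 π t`. -/
def circlePt (t : ℝ) : Sph 1 :=
  ⟨!₂[Real.cos (2 * Real.pi * t), Real.sin (2 * Real.pi * t)], by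
    rw [mem_sphere_zero_iff_norm, EuclideanSpace.norm_eq, Real.sqrt_eq_one]
    simp [Fin.sum_univ_two]⟩

/-- The loop `α` runs (at constant speed) through a closed edge path `e₀ e₁ … e_k`, `k ≥ 0`. -/
def MGraph.IsClosedEdgePath (Γ : MGraph.{u, v}) (α : C(Sph 1, Γ.Space)) : Prop :=
  ∃ (k : ℕ) (e : Fin (k + 1) → Γ.Dart),
    (∀ j, Γ.dartTgt (e j) = Γ.dartSrc (e (j + 1))) ∧
    ∀ (j : Fin (k + 1)) (t : unitInterval),
      α (circlePt (((j : ℕ) + (t : ℝ)) / (k + 1))) = Γ.dartPt (e j) t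

/-! ### Codes and their integral lifts -/

/-- A CSS code with sets `X`, `Z` of checks and set `Q` of qubits, as the complex
`𝔽₂^Z → 𝔽₂^Q → 𝔽₂^X` with boundary maps `HZᵀ` and `HX`. -/
structure CSSCode (X : Type u) (Q : Type v) (Z : Type w) [Fintype Q] where
  HX : Matrix X Q (ZMod 2)
  HZ : Matrix Z Q (ZMod 2)
  orthogonal : HX * HZ.transpose = 0

variable {X : Type u} {Q : Type v} {Z : Type w} [Fintype Q]

/-- A `ℤ`-lift of a CSS code: a complex `ℤ^Z → ℤ^Q → ℤ^X` which reduces to the code mod 2. -/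
structure ZLift (C : CSSCode X Q Z) where
  HX : Matrix X Q ℤ
  HZ : Matrix Z Q ℤ
  orthogonal : HX * HZ.transpose = 0
  HX_mod_two : HX.map (Int.cast : ℤ → ZMod 2) = C.HX
  HZ_mod_two : HZ.map (Int.cast : ℤ → ZMod 2) = C.HZ

namespace ZLift

variable {C : CSSCode X Q Z} (T : ZLift C)

/-- The edges of the lifted Tanner graph: `|HX x q|` edges between `x` and `q`. -/
abbrev TEdge : Type (max u v) := Σ p : X × Q, Fin (T.HX p.1 p.2).natAbs

/-- The vertices of the subgraph induced by the check `z` in the lifted Tanner graph: the qubits in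
the support of `z`, and the `X`-checks that have one of these qubits in their support. -/
def MemInduced (z : Z) : X ⊕ Q → Prop
  | Sum.inl x => ∃ q, T.HZ z q ≠ 0 ∧ T.HX x q ≠ 0
  | Sum.inr q => T.HZ z q ≠ 0

/-- The vertices of the induced subgraph of `z`. -/
abbrev IVertex (z : Z) : Type (max u v) := {a : X ⊕ Q // T.MemInduced z a}

/-- The edges of the induced subgraph of `z`. -/
abbrev IEdge (z : Z) : Type (max u v) := {e : T.TEdge // T.HZ z e.1.2 ≠ 0}

theorem HX_ne_zero (e : T.TEdge) : T.HX e.1.1 e.1.2 ≠ 0 := fun h => by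
  have := e.2.2
  simp [h] at this

/-- The `X`-end of an edge of the induced subgraph. -/
def IEdge.xEnd {T : ZLift C} {z : Z} (e : T.IEdge z) : T.IVertex z :=
  ⟨Sum.inl e.1.1.1, e.1.1.2, e.2, T.HX_ne_zero e.1⟩

/-- The `Q`-end of an edge of the induced subgraph. -/
def IEdge.qEnd {T : ZLift C} {z : Z} (e : T.IEdge z) : T.IVertex z := ⟨Sum.inr e.1.1.2, e.2⟩

/-! The graph with `|HZ z q|` copies of every qubit `q`, and its resolutions `G_z`. -/

/-- The copies of the qubits. -/
abbrev QCopy (z : Z) : Type v := Σ q : Q, Fin (T.HZ z q).natAbs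

/-- The edges at the copies of the qubits: an edge of the lifted Tanner graph with a copy of its
`Q`-end. -/
abbrev MEdge (z : Z) : Type (max u v) := Σ e : T.TEdge, Fin (T.HZ z e.1.2).natAbs

/-- The sign of such an edge. -/
def MEdge.sign {T : ZLift C} {z : Z} (m : T.MEdge z) : ℤ :=
  (T.HZ z m.1.1.2).sign * (T.HX m.1.1.1 m.1.1.2).sign

/-- A pairing, at each `X`-vertex, of the edges of opposite signs. -/
structure Pairing (z : Z) where
  partner : T.MEdge z → T.MEdge z
  involutive : Function.Involutive partner
  same_check : ∀ m, (partner m).1.1.1 = m.1.1.1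
  opposite_sign : ∀ m, (partner m).sign = -m.sign

/-- The graph `G_z` of a pairing. It has the copies of the qubits as `Q`-vertices, one `X`-vertex of
degree two for each pair, and the edges that form the pairs. -/
def Pairing.graph {T : ZLift C} {z : Z} (P : T.Pairing z) : MGraph where
  V := (Quot fun m m' : T.MEdge z => m' = P.partner m) ⊕ T.QCopy z
  E := T.MEdge z
  src m := Sum.inl (Quot.mk _ m)
  tgt m := Sum.inr ⟨m.1.1.2, m.2⟩

/-- The projection of `G_z` to the induced subgraph of `z`, on vertices. -/
def Pairing.proj {T : ZLift C} {z : Z} (P : T.Pairing z) : P.graph.V → T.IVertex z :=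
  Sum.elim
    (Quot.lift (fun m => ⟨Sum.inl m.1.1.1, m.1.1.2, fun h => by
        have := m.2.2
        simp [h] at this, T.HX_ne_zero m.1⟩) (by
      rintro m _ rfl
      simp [P.same_check]))
    (fun c => ⟨Sum.inr c.1, fun h => by
      have := c.2.2
      simp [h] at this⟩)

/-! The model of a `4`-cell. -/

/-- The star of the qubit `q`: an inner vertex `none`, and for every edge `e` at `q` an edge from its
own outer vertex `some e` to the inner vertex. -/
def starGraph (q : Q) : MGraph where
  V := Option {e : T.TEdge // e.1.2 = q}
  E := {e : T.TEdge // e.1.2 = q}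
  src e := some e
  tgt _ := none

/-- The attaching maps of the `3`-cells of the model: one `3`-cell at each outer vertex. -/
def modelThreeCells (q : Q) (e : {e : T.TEdge // e.1.2 = q}) : C(Sph 2, (T.starGraph q).Space) :=
  ContinuousMap.const _ ((T.starGraph q).vertex (some e))

/-- The star of `q` with a `3`-sphere at each outer vertex. A `4`-cell attached to it with incidence
numbers `±1` is a model of the punctured `4`-sphere with boundary these `3`-spheres. -/
abbrev Model (q : Q) : Type (max u v) := Attach 2 (T.modelThreeCells q)

/-- The core of the qubit `q` in the model: the attaching map of its `4`-cell, which has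
incidence number the sign of `HX x q` with every sphere attached to an edge between `x` and `q`. -/
structure Core (q : Q) where
  attach : C(Sph 3, T.Model q)
  incidence : ∀ e, HasIncidence (T.modelThreeCells q) attach e (T.HX e.1.1.1 e.1.1.2).sign

end ZLift

/-! ### Cellular realizations -/

/-- The `1`-skeleton of a cellular realization: the lifted Tanner graph, and for each
`Z`-check `z` finitely many further edges (the `Z`-type edges of `z`) between vertices of the induced
subgraph of `z`. -/
structure OneSkeleton {C : CSSCode X Q Z} (T : ZLift C) where
  ZEdge : Z → Type
  finite : ∀ z, Finite (ZEdge z)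
  zSrc : ∀ z, ZEdge z → T.IVertex z
  zTgt : ∀ z, ZEdge z → T.IVertex z

namespace OneSkeleton

variable {C : CSSCode X Q Z} {T : ZLift C} (S : OneSkeleton T)

/-- The underlying graph of the `1`-skeleton. -/
def graph : MGraph where
  V := X ⊕ Q
  E := T.TEdge ⊕ (Σ z, S.ZEdge z)
  src := Sum.elim (fun e => Sum.inl e.1.1) (fun e => (S.zSrc e.1 e.2).1)
  tgt := Sum.elim (fun e => Sum.inr e.1.2) (fun e => (S.zTgt e.1 e.2).1)

/-- The part of the `1`-skeleton that belongs to `z`: the induced subgraph of `z` with the `Z`-type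
edges of `z`. -/
def zGraph (z : Z) : MGraph where
  V := T.IVertex z
  E := T.IEdge z ⊕ S.ZEdge z
  src := Sum.elim (fun e => e.xEnd) (S.zSrc z)
  tgt := Sum.elim (fun e => e.qEnd) (S.zTgt z)

/-- The inclusion of this part in the `1`-skeleton. -/
def zIncl (z : Z) : (S.zGraph z).Hom S.graph where
  onV a := a.1
  onE := Sum.elim (fun e => Sum.inl e.1) (fun e => Sum.inr ⟨z, e⟩)
  src_onE := by rintro (e | e) <;> rfl
  tgt_onE := by rintro (e | e) <;> rfl

/-- The star of `q` maps to the `1`-skeleton. -/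
def starHom (q : Q) : (T.starGraph q).Hom S.graph where
  onV a := a.elim (Sum.inr q) fun e => Sum.inl e.1.1.1
  onE e := Sum.inl e.1
  src_onE _ := rfl
  tgt_onE e := congrArg Sum.inr e.2

/-- The star of a qubit `q` in the support of `z` maps to the part of `z`. -/
def starHomZ (z : Z) (q : Q) (h : T.HZ z q ≠ 0) : (T.starGraph q).Hom (S.zGraph z) where
  onV a := a.elim ⟨Sum.inr q, h⟩ fun e =>
    ⟨Sum.inl e.1.1.1, q, h, by have := T.HX_ne_zero e.1; rwa [e.2] at this⟩
  onE e := Sum.inl ⟨e.1, by rw [e.2]; exact h⟩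
  src_onE _ := rfl
  tgt_onE e := Subtype.ext (congrArg Sum.inr e.2)

end OneSkeleton

/-- The data of the `2`-cells of a cellular realization with given `1`-skeleton. -/
structure TwoCells {C : CSSCode X Q Z} {T : ZLift C} (S : OneSkeleton T) where
  /-- the choice of the graph `G_z` for each `z` -/
  pairing : ∀ z, T.Pairing z
  /-- the ends in `G_z` of the `Z`-type edges of `z` -/
  srcLift : ∀ z, S.ZEdge z → (pairing z).graph.V
  tgtLift : ∀ z, S.ZEdge z → (pairing z).graph.V
  proj_srcLift : ∀ z e, (pairing z).proj (srcLift z e) = S.zSrc z e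
  proj_tgtLift : ∀ z e, (pairing z).proj (tgtLift z e) = S.zTgt z e
  /-- the `Z`-type edges of `z` connect the components of `G_z` with each other -/
  connects : ∀ z (a b : (pairing z).graph.V), Relation.EqvGen
    (fun a b => (pairing z).graph.Joined a b ∨ ∃ e, srcLift z e = a ∧ tgtLift z e = b) a b
  /-- the `2`-cells that belong to `z` -/
  Face : Z → Type
  finite : ∀ z, Finite (Face z)
  /-- the attaching maps of these `2`-cells, with values in the part of the `1`-skeleton that
  belongs to `z` -/
  attach : ∀ z, Face z → C(Sph 1, (S.zGraph z).Space)
  isClosedEdgePath : ∀ z f, (S.zGraph z).IsClosedEdgePath (attach z f)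
  /-- the `2`-cells of `z` make the part that belongs to `z` simply connected -/
  simplyConnected : ∀ z, SimplyConnectedSpace (Attach 1 (attach z))

namespace TwoCells

variable {C : CSSCode X Q Z} {T : ZLift C} {S : OneSkeleton T} (D : TwoCells S)

/-- The part of the `2`-skeleton that belongs to `z`. -/
abbrev Part2 (z : Z) : Type (max u v) := Attach 1 (D.attach z)

/-- The attaching maps of all `2`-cells. -/
def attachAll (p : Σ z, D.Face z) : C(Sph 1, S.graph.Space) :=
  (S.zIncl p.1).map.comp (D.attach p.1 p.2)

/-- The `2`-skeleton. -/
abbrev Skel2 : Type (max u v w) := Attach 1 D.attachAll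

/-- The inclusion of the part that belongs to `z`. -/
def incl2 (z : Z) : C(D.Part2 z, D.Skel2) :=
  Attach.map (S.zIncl z).map (fun f => ⟨z, f⟩) (fun _ _ => rfl)

/-- For each `X`-check `x` a `3`-cell is attached to the vertex `x`, forming a `3`-sphere. -/
def attach3 (x : X) : C(Sph 2, D.Skel2) :=
  ContinuousMap.const _ (Attach.base D.attachAll (S.graph.vertex (Sum.inl x)))

/-- The `3`-skeleton. -/
abbrev Skel3 : Type (max u v w) := Attach 2 D.attach3

/-- The `3`-cells of the part that belongs to `z`. -/
def attach3Z (z : Z) (x : {x : X // T.MemInduced z (Sum.inl x)}) : C(Sph 2, D.Part2 z) :=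
  ContinuousMap.const _ (Attach.base (D.attach z) ((S.zGraph z).vertex ⟨Sum.inl x.1, x.2⟩))

/-- The part of the `3`-skeleton that belongs to `z`. -/
abbrev Part3 (z : Z) : Type (max u v) := Attach 2 (D.attach3Z z)

/-- The inclusion of the part that belongs to `z`. -/
def incl3 (z : Z) : C(D.Part3 z, D.Skel3) :=
  Attach.map (D.incl2 z) (fun x => x.1) (fun _ _ => rfl)

/-- The map from the model of `q` to the `3`-skeleton: it sends each edge of the star to the edge of
which it is a copy, and the `3`-cell at the outer vertex of an edge between `x` and `q` to the
`3`-cell of `x`. -/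
def modelMap (q : Q) : C(T.Model q, D.Skel3) :=
  Attach.map ((Attach.base D.attachAll).comp (S.starHom q).map) (fun e => e.1.1.1)
    (fun _ _ => rfl)

/-- The same map to the part that belongs to `z`, for `q` in the support of `z`. -/
def modelMapZ (z : Z) (q : Q) (h : T.HZ z q ≠ 0) : C(T.Model q, D.Part3 z) :=
  Attach.map ((Attach.base (D.attach z)).comp (S.starHomZ z q h).map)
    (fun e => ⟨e.1.1.1, q, h, by have := T.HX_ne_zero e.1; rwa [e.2] at this⟩) (fun _ _ => rfl)

theorem incl3_modelMapZ (z : Z) (q : Q) (h : T.HZ z q ≠ 0) (a : T.Model q) :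
    D.incl3 z (D.modelMapZ z q h a) = D.modelMap q a := by
  induction a using Attach.induction_on with
  | hb b =>
    induction b using Attach.induction_on with
    | hb c => rcases c with _ | c <;> rfl
    | hc i d => rfl
  | hc i d => rfl

variable (κ : ∀ q, T.Core q)

/-- The attaching map of the `4`-cell of the qubit `q`. -/
def attach4 (q : Q) : C(Sph 3, D.Skel3) := (D.modelMap q).comp (κ q).attach

/-- The `4`-skeleton. -/
abbrev Skel4 : Type (max u v w) := Attach 3 (D.attach4 κ)

/-- The attaching maps of the `4`-cells of the part that belongs to `z`, one for each qubit in the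
support of `z`. -/
def attach4Z (z : Z) (q : {q : Q // T.HZ z q ≠ 0}) : C(Sph 3, D.Part3 z) :=
  (D.modelMapZ z q.1 q.2).comp (κ q.1).attach

/-- The part of the `4`-skeleton that belongs to `z`. -/
abbrev Part4 (z : Z) : Type (max u v) := Attach 3 (D.attach4Z κ z)

/-- The inclusion of the part that belongs to `z`. -/
def incl4 (z : Z) : C(D.Part4 κ z, D.Skel4 κ) :=
  Attach.map (D.incl3 z) (fun q => q.1)
    (fun q s => (D.incl3_modelMapZ z q.1 q.2 ((κ q.1).attach s)).symm)

end TwoCells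

/-- A cellular realization of the code `C` (with fixed `ℤ`-lift `T`) that has the `1`-skeleton `S`.
It has a `3`-cell for each `X`-check, a `4`-cell for each qubit and a `5`-cell for each `Z`-check.
The `5`-cell of `z` is attached to the part of the `4`-skeleton that belongs to `z`, with
incidence numbers `HZ z q`. -/
structure CellularRealization {C : CSSCode X Q Z} {T : ZLift C} (S : OneSkeleton T) where
  twoCells : TwoCells S
  core : ∀ q, T.Core q
  cap : ∀ z, C(Sph 4, twoCells.Part4 core z)
  incidence : ∀ z q, HasIncidence (twoCells.attach4Z core z) (cap z) q (T.HZ z q.1)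

namespace CellularRealization

variable {C : CSSCode X Q Z} {T : ZLift C} {S : OneSkeleton T} (L : CellularRealization S)

/-- The attaching map of the `5`-cell of the check `z`. -/
def attach5 (z : Z) : C(Sph 4, L.twoCells.Skel4 L.core) :=
  (L.twoCells.incl4 L.core z).comp (L.cap z)

/-- The underlying topological space of a cellular realization. -/
abbrev Space : Type (max u v w) := Attach 4 L.attach5

/-- The inclusion of the `1`-skeleton. -/
def incl : C(S.graph.Space, L.Space) :=
  (Attach.base L.attach5).comp ((Attach.base (L.twoCells.attach4 L.core)).comp
    ((Attach.base L.twoCells.attach3).comp (Attach.base L.twoCells.attachAll)))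

end CellularRealization

end CSSRealization

end

noncomputable section

namespace CSSRealization

open Metric Topology Set
open scoped unitInterval

universe u v w

/-! ### Topology of a space with attached cells -/

namespace Attach

variable {A : Type u} [TopologicalSpace A] {ι : Type v} {n : ℕ} (φ : ι → C(Sph n, A))

/-! Fix a base point in the common 1-skeleton. The fundamental group of each realization is a
quotient of that of the 1-skeleton, because every loop can be pushed off the cells of dimension at
least 2. So it suffices that the same loops of the 1-skeleton die in both realizations.

Cells of dimension at least 3 kill nothing, since null-homotopies can be pushed off them as well;
only the 2-skeletons matter. The boundary of a 2-cell of `z` in the first realization lies in the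
part of the 1-skeleton that belongs to `z`, and the 2-cells of `z` in the second realization make
this part simply connected. The boundary therefore bounds a disk there, and these disks define a map
between the 2-skeletons that is the identity on the 1-skeleton (`exists_comparison`). It carries
null-homotopies across, and by symmetry the two kernels agree.

The pushing is done by `exists_homotopy_to_base`: a map from an interval or a square into an open
cell of larger dimension can be perturbed to miss a point near the center of the cell, and then
expanded radially to the boundary. All cells are treated at once, relative to the preimage of the
base. This makes the inclusion of the base full (`isPathFull_base`) and faithful
(`isPathFaithful_base`) on fundamental groupoids. -/

theorem toDisk_injective : Function.Injective (Sph.toDisk (n := n)) := fun _ _ h =>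
  Subtype.ext (Subtype.mk.inj h)

theorem continuous_toDisk : Continuous (Sph.toDisk (n := n)) :=
  continuous_subtype_val.subtype_mk _

/-- The points of `A` that are glued to a given point of the space obtained by attaching cells. -/
def trace : Attach n φ → Set A :=
  Quot.lift (Sum.elim (fun a => {a}) fun p => {b | ∃ s : Sph n, s.toDisk = p.2 ∧ φ p.1 s = b}) (by
    rintro _ _ ⟨i, s⟩
    ext b
    simp only [Sum.elim_inr, Sum.elim_inl, mem_ofPred_eq, mem_singleton_iff]
    constructor
    · rintro ⟨t, ht, rfl⟩
      rw [toDisk_injective ht]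
    · rintro rfl
      exact ⟨s, rfl, rfl⟩)

theorem trace_base (a : A) : trace φ (base φ a) = {a} := rfl

theorem trace_cell (i : ι) (d : Disk (n + 1)) :
    trace φ (cell φ i d) = {b | ∃ s : Sph n, s.toDisk = d ∧ φ i s = b} := rfl

theorem base_injective : Function.Injective (base φ) := fun a b h => by
  have := congrArg (trace φ) h
  simpa only [trace_base, singleton_eq_singleton_iff] using this

theorem mem_base_image_iff (C : Set A) (x : Attach n φ) :
    x ∈ base φ '' C ↔ (trace φ x ∩ C).Nonempty := by
  induction x using Attach.induction_on with
  | hb a =>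
    rw [(base_injective φ).mem_set_image, trace_base, singleton_inter_nonempty]
  | hc i d =>
    rw [trace_cell]
    constructor
    · rintro ⟨a, ha, h⟩
      have : a ∈ trace φ (cell φ i d) := by
        rw [← h]
        exact mem_singleton a
      exact ⟨a, this, ha⟩
    · rintro ⟨b, ⟨s, rfl, rfl⟩, hb⟩
      exact ⟨_, hb, (cell_toDisk φ i s).symm⟩

/-- Closedness of an image is tested on `A` and on each disk separately. `trace` computes the two
preimages: the closed set itself, and the image in the disk of a closed subset of the compact
sphere. -/
theorem isClosedEmbedding_base : IsClosedEmbedding (base φ) := by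
  refine .of_continuous_injective_isClosedMap (base φ).continuous (base_injective φ) fun C hC => ?_
  have h : base φ '' C = {x | (trace φ x ∩ C).Nonempty} := by
    ext x
    exact mem_base_image_iff φ C x
  rw [h]
  refine isQuotientMap_quot_mk.isClosed_preimage.mp (isClosed_sum_iff.mpr ⟨?_, ?_⟩)
  · convert hC using 1
    ext a
    exact singleton_inter_nonempty
  · refine isClosed_sigma_iff.mpr fun i => ?_
    have hcl : IsClosed (Sph.toDisk '' (φ i ⁻¹' C)) :=
      ((hC.preimage (φ i).continuous).isCompact.image continuous_toDisk).isClosed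
    convert hcl using 1
    ext d
    constructor
    · rintro ⟨_, ⟨s, hs, rfl⟩, hb⟩
      exact ⟨s, hb, hs⟩
    · rintro ⟨s, hs, rfl⟩
      exact ⟨_, ⟨s, rfl, rfl⟩, hs⟩

/-- A family of self-maps of the disk that fix the boundary acts on all cells. -/
theorem exists_action {P : Type*} [TopologicalSpace P] [LocallyCompactSpace P]
    (m : C(Disk (n + 1) × P, Disk (n + 1))) (hm : ∀ (s : Sph n) p, m (s.toDisk, p) = s.toDisk) :
    ∃ M : C(Attach n φ × P, Attach n φ), (∀ a p, M (base φ a, p) = base φ a) ∧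
      ∀ i d p, M (cell φ i d, p) = cell φ i (m (d, p)) := by
  -- Currying avoids the question whether the product of `P` with a quotient map is again a quotient
  -- map; local compactness of `P` allows uncurrying.
  exact ⟨(desc (B := C(P, Attach n φ)) ((base φ).comp ContinuousMap.fst).curry
    (fun i => ((cell φ i).comp m).curry) (fun i s => by
      ext p
      change cell φ i (m (s.toDisk, p)) = base φ (φ i s)
      rw [hm, cell_toDisk])).uncurry, fun _ _ => rfl, fun _ _ _ => rfl⟩

end Attach

/-! ### Pushing the disk to its boundary -/

/-- The radial projection to the disk. -/
def toUnitDisk (n : ℕ) (u : EuclideanSpace ℝ (Fin n)) : Disk n :=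
  ⟨(max 1 ‖u‖)⁻¹ • u, by
    have h : 0 < max 1 ‖u‖ := lt_max_of_lt_left one_pos
    rw [mem_closedBall_zero_iff, norm_smul, norm_inv, Real.norm_of_nonneg h.le,
      inv_mul_le_iff₀ h, mul_one]
    exact le_max_right _ _⟩

theorem continuous_toUnitDisk (n : ℕ) : Continuous (toUnitDisk n) := by
  refine Continuous.subtype_mk (Continuous.smul (Continuous.inv₀
    (continuous_const.max continuous_norm) fun u => ?_) continuous_id) _
  exact (lt_max_of_lt_left one_pos).ne'

theorem toUnitDisk_of_mem {n : ℕ} (d : Disk n) : toUnitDisk n d.1 = d := by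
  have h : ‖d.1‖ ≤ 1 := mem_closedBall_zero_iff.mp d.2
  apply Subtype.ext
  simp [toUnitDisk, h]

theorem toUnitDisk_mem_range {n : ℕ} {u : EuclideanSpace ℝ (Fin (n + 1))} (hu : 1 ≤ ‖u‖) :
    ∃ s : Sph n, toUnitDisk (n + 1) u = s.toDisk := by
  refine ⟨⟨(max 1 ‖u‖)⁻¹ • u, ?_⟩, rfl⟩
  rw [mem_sphere_zero_iff_norm, max_eq_right hu, norm_smul, norm_inv, norm_norm]
  exact inv_mul_cancel₀ (by positivity)

/-- A cutoff function on the disk, `1` on the disk of radius `1 / 2` and `0` on the boundary. -/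
def cutoff {n : ℕ} (d : Disk n) : ℝ := min 1 (2 * (1 - ‖d.1‖))

theorem continuous_cutoff {n : ℕ} : Continuous (cutoff (n := n)) := by
  unfold cutoff
  fun_prop

theorem cutoff_toDisk {n : ℕ} (s : Sph n) : cutoff s.toDisk = 0 := by
  have hs : ‖s.1‖ = 1 := mem_sphere_zero_iff_norm.mp s.2
  simp [cutoff, Sph.toDisk, hs]

theorem cutoff_of_le {n : ℕ} {d : Disk n} (h : ‖d.1‖ ≤ 1 / 2) : cutoff d = 1 :=
  min_eq_left (by linarith)

theorem cutoff_nonneg {n : ℕ} (d : Disk n) : 0 ≤ cutoff d := by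
  have h : ‖d.1‖ ≤ 1 := mem_closedBall_zero_iff.mp d.2
  exact le_min zero_le_one (by linarith)

theorem cutoff_le_one {n : ℕ} (d : Disk n) : cutoff d ≤ 1 := min_le_left _ _

/-- Translate the points near the center of the disk by `w`, and stretch by the factor `K ≥ 1`. -/
def pushDisk (n : ℕ) : C(Disk n × (EuclideanSpace ℝ (Fin n) × ℝ), Disk n) where
  toFun p := toUnitDisk n ((max 1 p.2.2) • (p.1.1 + cutoff p.1 • p.2.1))
  continuous_toFun := by
    have := continuous_cutoff (n := n)
    refine (continuous_toUnitDisk n).comp ?_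
    fun_prop

/-- On the boundary the cutoff kills the translation, and the radial projection undoes the
stretching. This is what lets the push act on all cells while fixing the base. -/
theorem pushDisk_toDisk {n : ℕ} (s : Sph n) (p) : pushDisk (n + 1) (s.toDisk, p) = s.toDisk := by
  have hs : ‖s.1‖ = 1 := mem_sphere_zero_iff_norm.mp s.2
  have h1 : (1 : ℝ) ≤ max 1 p.2 := le_max_left _ _
  have h0 : (0 : ℝ) < max 1 p.2 := by linarith
  apply Subtype.ext
  simp only [pushDisk, ContinuousMap.coe_mk, toUnitDisk, cutoff_toDisk, zero_smul, add_zero]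
  simp [norm_smul, Sph.toDisk, hs, abs_of_pos h0, smul_smul, h0.ne']

theorem pushDisk_zero {n : ℕ} (d : Disk n) : pushDisk n (d, (0, 1)) = d := by
  simp [pushDisk, toUnitDisk_of_mem]

/-- Stretching past norm 1 lands on the boundary. Outside radius 1/2 this is automatic: the
translated point has norm at least 1/2 - 1/4, and `K ≥ 4`. Inside, the cutoff is 1, and the
hypothesis `h` is exactly what is needed. -/
theorem pushDisk_mem_range {n : ℕ} {d : Disk (n + 1)} {w : EuclideanSpace ℝ (Fin (n + 1))} {K : ℝ}
    (hw : ‖w‖ ≤ 1 / 4) (hK : 4 ≤ K) (h : ‖d.1‖ ≤ 1 / 2 → 1 ≤ K * ‖d.1 + w‖) :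
    ∃ s : Sph n, pushDisk (n + 1) (d, (w, K)) = s.toDisk := by
  apply toUnitDisk_mem_range
  have h1 : max 1 K = K := max_eq_right (by linarith)
  simp only [h1, norm_smul, Real.norm_of_nonneg (show 0 ≤ K by linarith)]
  rcases le_or_gt ‖d.1‖ (1 / 2) with hd | hd
  · rw [cutoff_of_le hd, one_smul]
    exact h hd
  · have h2 : ‖cutoff d • w‖ ≤ 1 / 4 := by
      rw [norm_smul, Real.norm_of_nonneg (cutoff_nonneg d)]
      exact (mul_le_of_le_one_left (norm_nonneg w) (cutoff_le_one d)).trans hw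
    have h3 : ‖d.1‖ - ‖cutoff d • w‖ ≤ ‖d.1 + cutoff d • w‖ := norm_sub_le_norm_add _ _
    nlinarith

/-! ### General position -/

/-- The maps from `W` to `ℝᵏ` can be approximated by maps whose image has dense complement. -/
def CanAvoidPoints (W : Type*) [TopologicalSpace W] (k : ℕ) : Prop :=
  ∀ (u : C(W, EuclideanSpace ℝ (Fin k))) (ε : ℝ), 0 < ε →
    ∃ g : C(W, EuclideanSpace ℝ (Fin k)), (∀ s, ‖g s - u s‖ < ε) ∧ Dense (range g)ᶜ

theorem canAvoidPoints_of_retract {W E : Type*} [TopologicalSpace W] [NormedAddCommGroup E]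
    [NormedSpace ℝ E] [FiniteDimensional ℝ E] (j : C(W, E)) (r : C(E, W)) (hr : ∀ s, r (j s) = s)
    {k : ℕ} (hk : Module.finrank ℝ E < k) : CanAvoidPoints W k := by
  intro u ε hε
  -- The retraction extends `u` to all of `E`, where a C¹ approximation exists; a C¹ image of a
  -- space of dimension less than `k` has dense complement.
  obtain ⟨g, hg, hgu, -⟩ := (u.comp r).continuous.exists_contDiff_approx 1
    (continuous_const (y := ε)) (fun _ => hε)
  refine ⟨⟨g ∘ j, hg.continuous.comp j.continuous⟩, fun s => ?_, ?_⟩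
  · simpa [hr, dist_eq_norm] using hgu (j s)
  · refine (hg.dense_compl_range_of_finrank_lt_finrank (by simpa using hk)).mono ?_
    exact compl_subset_compl.mpr (range_comp_subset_range j g)

theorem canAvoidPoints_unitInterval {k : ℕ} (hk : 1 < k) : CanAvoidPoints I k :=
  canAvoidPoints_of_retract ⟨Subtype.val, continuous_subtype_val⟩
    ⟨projIcc 0 1 zero_le_one, continuous_projIcc⟩ (fun s => projIcc_val zero_le_one s)
    (by simpa using hk)

theorem canAvoidPoints_unitSquare {k : ℕ} (hk : 2 < k) : CanAvoidPoints (I × I) k :=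
  canAvoidPoints_of_retract (E := ℝ × ℝ)
    ⟨Prod.map Subtype.val Subtype.val, by fun_prop⟩
    ⟨Prod.map (projIcc 0 1 zero_le_one) (projIcc 0 1 zero_le_one),
      continuous_projIcc.prodMap continuous_projIcc⟩
    (fun s => Prod.ext (projIcc_val zero_le_one s.1) (projIcc_val zero_le_one s.2))
    (by simpa using hk)

/-! ### Deforming maps off the cells -/

namespace Attach

variable {A : Type u} [TopologicalSpace A] {ι : Type v} {n : ℕ} (φ : ι → C(Sph n, A))

/-- The coordinate in the cells, cut off at the boundary. -/
def coord : C(Attach n φ, EuclideanSpace ℝ (Fin (n + 1))) :=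
  desc (ContinuousMap.const _ 0)
    (fun _ => ⟨fun d => cutoff d • d.1, continuous_cutoff.smul continuous_subtype_val⟩)
    (fun i s => by simp [cutoff_toDisk])

/-- A map from a space of small dimension is homotopic, relative to the preimage of `A`, to a map
with values in `A`. -/
theorem exists_homotopy_to_base {W : Type*} [TopologicalSpace W] [CompactSpace W]
    (hW : CanAvoidPoints W (n + 1)) (H : C(W, Attach n φ)) :
    ∃ (F : C(I × W, Attach n φ)) (H' : C(W, A)), (∀ s, F (0, s) = H s) ∧
      (∀ s, F (1, s) = base φ (H' s)) ∧ ∀ t s a, H s = base φ a → F (t, s) = base φ a := by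
  obtain ⟨M, hMb, hMc⟩ := exists_action φ (pushDisk (n + 1)) pushDisk_toDisk
  -- The two bounds 1/8, for the approximation and for the avoided point `c`, add up to the bound
  -- 1/4 on the translation that `pushDisk_mem_range` requires.
  obtain ⟨g, hgu, hg⟩ := hW ((coord φ).comp H) (1 / 8) (by norm_num)
  obtain ⟨c, hc, hc0⟩ := hg.exists_dist_lt 0 (show (0 : ℝ) < 1 / 8 by norm_num)
  have hc0 : ‖c‖ < 1 / 8 := by simpa using hc0
  have hcomp : IsCompact (range g) := isCompact_range g.continuous
  obtain ⟨δ, hδ, hδc⟩ := Metric.isOpen_iff.mp hcomp.isClosed.isOpen_compl c hc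
  have hgc : ∀ s, δ ≤ ‖g s - c‖ := fun s => by
    by_contra! h
    exact hδc (mem_ball_iff_norm.mpr h) (mem_range_self s)
  -- By compactness the image of `g` keeps a distance `δ` from `c`; stretching by `δ⁻¹` or more
  -- moves `g s - c` out of the open unit ball.
  let K : ℝ := max 4 δ⁻¹
  have hK4 : 4 ≤ K := le_max_left _ _
  have hKδ : 1 ≤ K * δ := by
    calc 1 = δ⁻¹ * δ := (inv_mul_cancel₀ hδ.ne').symm
      _ ≤ K * δ := by gcongr; exact le_max_right _ _
  let w : C(W, EuclideanSpace ℝ (Fin (n + 1))) :=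
    ⟨fun s => g s - c - coord φ (H s), by fun_prop⟩
  have hw : ∀ s, ‖w s‖ ≤ 1 / 4 := fun s => by
    have h1 : w s = (g s - coord φ (H s)) - c := by simp only [w, ContinuousMap.coe_mk]; abel
    rw [h1]
    refine (norm_sub_le _ _).trans ?_
    have := hgu s
    simp only [ContinuousMap.comp_apply] at this
    linarith
  -- The parameters move linearly from `(0, 1)`, which acts as the identity, to `(w s, K)`.
  let F : C(I × W, Attach n φ) :=
    ⟨fun q => M (H q.2, ((q.1 : ℝ) • w q.2, 1 + (q.1 : ℝ) * (K - 1))), by fun_prop⟩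
  have hF1 : ∀ s, ∃ a, base φ a = F (1, s) := fun s => by
    have hs : F (1, s) = M (H s, (w s, K)) := by simp [F]
    have hws : w s = g s - c - coord φ (H s) := rfl
    have hwn := hw s
    rw [hs]
    generalize H s = x at hws ⊢
    induction x using Attach.induction_on with
    | hb a => exact ⟨a, (hMb _ _).symm⟩
    | hc i d =>
      -- Near the center of a cell `coord` is the true coordinate `d`, so the translation by `w s`
      -- replaces it by `g s - c`, of norm at least `δ`.
      obtain ⟨b, hb⟩ := pushDisk_mem_range (d := d) hwn hK4 (fun hd => by
        have h2 : coord φ (cell φ i d) = cutoff d • d.1 := rfl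
        rw [hws, h2, cutoff_of_le hd, one_smul, add_sub_cancel]
        exact hKδ.trans (mul_le_mul_of_nonneg_left (hgc s) (by linarith)))
      exact ⟨φ i b, by rw [hMc, hb, cell_toDisk]⟩
  choose H' hH' using hF1
  refine ⟨F, ⟨H', ?_⟩, fun s => ?_, fun s => (hH' s).symm, fun t s a h => ?_⟩
  · rw [(isClosedEmbedding_base φ).continuous_iff]
    have : base φ ∘ H' = fun s => F (1, s) := funext hH'
    rw [this]
    fun_prop
  · have hs : F (0, s) = M (H s, (0, 1)) := by simp [F]
    rw [hs]
    generalize H s = x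
    induction x using Attach.induction_on with
    | hb a => exact hMb _ _
    | hc i d => rw [hMc, pushDisk_zero]
  · change M (H s, _) = _
    rw [h, hMb]

/-- Every disk is path connected and has a boundary point, which is glued to `A`. -/
theorem pathConnectedSpace [PathConnectedSpace A] : PathConnectedSpace (Attach n φ) := by
  have key : ∀ x : Attach n φ, ∃ a, Joined (base φ a) x := fun x => by
    induction x using Attach.induction_on with
    | hb a => exact ⟨a, Joined.refl _⟩
    | hc i d =>
      have : PathConnectedSpace (Disk (n + 1)) :=
        isPathConnected_iff_pathConnectedSpace.mp
          ((convex_closedBall _ _).isPathConnected ⟨0, by simp⟩)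
      let s : Sph n := ⟨EuclideanSpace.single 0 1, by simp⟩
      refine ⟨φ i s, ?_⟩
      rw [← cell_toDisk]
      exact (PathConnectedSpace.joined s.toDisk d).map (cell φ i).continuous
  obtain ⟨a₀⟩ := PathConnectedSpace.nonempty (X := A)
  refine ⟨⟨base φ a₀⟩, fun x y => ?_⟩
  obtain ⟨a, ha⟩ := key x
  obtain ⟨b, hb⟩ := key y
  exact ha.symm.trans (((PathConnectedSpace.joined a b).map (base φ).continuous).trans hb)

end Attach

/-! ### Fundamental groups -/

section PathLifting

variable {A B D : Type*} [TopologicalSpace A] [TopologicalSpace B] [TopologicalSpace D]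

/-- The map of fundamental groupoids induced by `f` is full. -/
def IsPathFull (f : C(A, B)) : Prop :=
  ∀ (a b : A) (γ : Path (f a) (f b)), ∃ γ' : Path a b, γ.Homotopic (γ'.map f.continuous)

/-- The map of fundamental groupoids induced by `f` is faithful. -/
def IsPathFaithful (f : C(A, B)) : Prop :=
  ∀ (a b : A) (γ γ' : Path a b),
    (γ.map f.continuous).Homotopic (γ'.map f.continuous) → γ.Homotopic γ'

theorem IsPathFull.comp {g : C(B, D)} {f : C(A, B)} (hg : IsPathFull g) (hf : IsPathFull f) :
    IsPathFull (g.comp f) := fun a b γ => by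
  obtain ⟨γ₁, h₁⟩ := hg (f a) (f b) γ
  obtain ⟨γ₂, h₂⟩ := hf a b γ₁
  exact ⟨γ₂, h₁.trans (h₂.map g)⟩

theorem IsPathFaithful.comp {g : C(B, D)} {f : C(A, B)} (hg : IsPathFaithful g)
    (hf : IsPathFaithful f) : IsPathFaithful (g.comp f) := fun a b γ γ' h =>
  hf a b γ γ' (hg _ _ (γ.map f.continuous) (γ'.map f.continuous) h)

theorem IsPathFull.map_surjective {f : C(A, B)} (hf : IsPathFull f) (a : A) :
    Function.Surjective (FundamentalGroup.map f a) := fun x => by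
  obtain ⟨γ, rfl⟩ := Path.Homotopic.Quotient.mk_surjective x
  obtain ⟨γ', h⟩ := hf a a γ
  exact ⟨Path.Homotopic.Quotient.mk γ', (Path.Homotopic.Quotient.eq.mpr h).symm⟩

theorem map_mk_eq_one_iff (f : C(A, B)) (a : A) (γ : Path a a) :
    FundamentalGroup.map f a (Path.Homotopic.Quotient.mk γ) = 1 ↔
      (γ.map f.continuous).Homotopic (Path.refl (f a)) :=
  Path.Homotopic.Quotient.eq

/-- If two maps are surjective on fundamental groups, and the same loops become null-homotopic, then
the fundamental groups of their targets are isomorphic. -/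
theorem nonempty_mulEquiv_of_nullhomotopic_iff {f : C(A, B)} {g : C(A, D)} (hf : IsPathFull f)
    (hg : IsPathFull g) (a : A)
    (h : ∀ γ : Path a a, (γ.map f.continuous).Homotopic (Path.refl (f a)) ↔
      (γ.map g.continuous).Homotopic (Path.refl (g a))) :
    Nonempty (FundamentalGroup B (f a) ≃* FundamentalGroup D (g a)) := by
  -- Both groups are the quotient of the fundamental group of `A` by this common kernel.
  have hker : (FundamentalGroup.map f a).ker = (FundamentalGroup.map g a).ker := by
    ext x
    obtain ⟨γ, rfl⟩ := Path.Homotopic.Quotient.mk_surjective x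
    rw [MonoidHom.mem_ker, MonoidHom.mem_ker]
    exact (map_mk_eq_one_iff f a γ).trans ((h γ).trans (map_mk_eq_one_iff g a γ).symm)
  exact ⟨((QuotientGroup.quotientKerEquivOfSurjective _ (hf.map_surjective a)).symm.trans
    (QuotientGroup.quotientMulEquivOfEq hker)).trans
    (QuotientGroup.quotientKerEquivOfSurjective _ (hg.map_surjective a))⟩

end PathLifting

/-! ### Fundamental groupoids under attaching cells -/

namespace Attach

variable {A : Type u} [TopologicalSpace A] {ι : Type v} {n : ℕ} (φ : ι → C(Sph n, A))

/-- The interval has dimension 1, less than that of the cells, so the path can be deformed into `A`.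
The ends already lie in `A` and stay fixed. -/
theorem isPathFull_base (hn : 1 ≤ n) : IsPathFull (base φ) := fun a b γ => by
  obtain ⟨F, H', h0, h1, hb⟩ := exists_homotopy_to_base φ
    (canAvoidPoints_unitInterval (show 1 < n + 1 by omega)) γ.toContinuousMap
  have e0 : H' 0 = a := base_injective φ ((h1 0).symm.trans (hb 1 0 a γ.source))
  have e1 : H' 1 = b := base_injective φ ((h1 1).symm.trans (hb 1 1 b γ.target))
  refine ⟨⟨H', e0, e1⟩, ⟨⟨⟨F, h0, h1⟩, fun t s hs => ?_⟩⟩⟩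
  rcases hs with rfl | rfl
  · exact (hb t 0 a γ.source).trans γ.source.symm
  · exact (hb t 1 b γ.target).trans γ.target.symm

/-- The same deformation is applied to the square of a homotopy, which needs cells of dimension at
least 3. All four sides lie in `A`, so the deformed square is a homotopy in `A` between the same
paths. -/
theorem isPathFaithful_base (hn : 2 ≤ n) : IsPathFaithful (base φ) := fun a b γ γ' ⟨G⟩ => by
  obtain ⟨F, H', h0, h1, hb⟩ := exists_homotopy_to_base φ
    (canAvoidPoints_unitSquare (show 2 < n + 1 by omega)) G.toContinuousMap
  have key : ∀ s c, G s = base φ c → H' s = c := fun s c h =>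
    base_injective φ ((h1 s).symm.trans (hb 1 s c h))
  refine ⟨⟨⟨H', fun s => key _ _ (G.apply_zero s), fun s => key _ _ (G.apply_one s)⟩,
    fun t s hs => ?_⟩⟩
  rcases hs with rfl | rfl
  · exact (key _ _ (G.source t)).trans γ.source.symm
  · exact (key _ _ (G.target t)).trans γ.target.symm

end Attach

/-! ### Extension of loops over the disk -/

theorem continuous_circlePt : Continuous circlePt := by
  refine Continuous.subtype_mk ((PiLp.continuous_toLp 2 _).comp (continuous_pi fun i => ?_)) _
  fin_cases i
  · simp only [Fin.zero_eta, Matrix.cons_val_zero]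
    fun_prop
  · simp only [Fin.mk_one, Matrix.cons_val_one]
    fun_prop

theorem circlePt_zero_eq_one : circlePt 0 = circlePt 1 := by
  apply Subtype.ext
  simp [circlePt]

theorem exists_circlePt_eq (s : Sph 1) : ∃ t : I, circlePt t = s := by
  have hs : ‖s.1‖ = 1 := mem_sphere_zero_iff_norm.mp s.2
  rw [EuclideanSpace.norm_eq, Real.sqrt_eq_one, Fin.sum_univ_two] at hs
  simp only [Real.norm_eq_abs, sq_abs] at hs
  let z : ℂ := ⟨s.1 0, s.1 1⟩
  have hz : ‖z‖ = 1 := by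
    rw [← sq_eq_sq₀ (norm_nonneg _) zero_le_one, Complex.sq_norm, Complex.normSq_apply]
    simp only [z]
    linarith
  have hz0 : z ≠ 0 := fun h => by simp [h] at hz
  have hpi := Real.pi_pos
  -- The argument is moved to `[0, 2π)`, so that dividing by `2π` gives a parameter in the unit
  -- interval.
  let θ := toIcoMod Real.two_pi_pos 0 z.arg
  have hθ := toIcoMod_mem_Ico' Real.two_pi_pos z.arg
  have hθz : θ = z.arg - toIcoDiv Real.two_pi_pos 0 z.arg * (2 * Real.pi) := by
    rw [← zsmul_eq_mul]
    rfl
  have hc : Real.cos θ = s.1 0 := by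
    rw [hθz, Real.cos_sub_int_mul_two_pi, Complex.cos_arg hz0, hz, div_one]
  have hsn : Real.sin θ = s.1 1 := by
    rw [hθz, Real.sin_sub_int_mul_two_pi, Complex.sin_arg, hz, div_one]
  refine ⟨⟨θ / (2 * Real.pi), div_nonneg hθ.1 (by positivity),
    (div_le_one (by positivity)).mpr hθ.2.le⟩, Subtype.ext ?_⟩
  have h2 : 2 * Real.pi * (θ / (2 * Real.pi)) = θ := by field_simp
  ext i
  fin_cases i
  · simpa [circlePt, h2] using hc
  · simpa [circlePt, h2] using hsn

/-- Cosine and sine determine `t` modulo 1, and two points of the unit interval differ by a non-zero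
integer only if they are its two ends. -/
theorem circlePt_eq_iff {t t' : I} (h : circlePt t = circlePt t') :
    t = t' ∨ (t = 0 ∨ t = 1) ∧ (t' = 0 ∨ t' = 1) := by
  have h0 : Real.cos (2 * Real.pi * t) = Real.cos (2 * Real.pi * t') := by
    simpa [circlePt] using congrArg (fun s : Sph 1 => s.1 0) h
  have h1 : Real.sin (2 * Real.pi * t) = Real.sin (2 * Real.pi * t') := by
    simpa [circlePt] using congrArg (fun s : Sph 1 => s.1 1) h
  obtain ⟨k, hk⟩ := Real.Angle.angle_eq_iff_two_pi_dvd_sub.mp (Real.Angle.cos_sin_inj h0 h1)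
  have hk : (t : ℝ) - t' = k := by
    have : 2 * Real.pi * ((t : ℝ) - t') = 2 * Real.pi * k := by linarith
    exact mul_left_cancel₀ Real.two_pi_pos.ne' this
  have ht := t.2
  have ht' := t'.2
  simp only [mem_Icc] at ht ht'
  have hk1 : k ≤ 1 := by exact_mod_cast (show (k : ℝ) ≤ 1 by linarith)
  have hk2 : -1 ≤ k := by exact_mod_cast (show (-1 : ℝ) ≤ k by linarith)
  have : k = -1 ∨ k = 0 ∨ k = 1 := by omega
  rcases this with rfl | rfl | rfl
  · right
    push_cast at hk
    exact ⟨Or.inl (Subtype.ext (by rw [Icc.coe_zero]; linarith)), Or.inr (Subtype.ext (by rw [Icc.coe_one]; linarith))⟩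
  · left
    push_cast at hk
    exact Subtype.ext (by linarith)
  · right
    push_cast at hk
    exact ⟨Or.inr (Subtype.ext (by rw [Icc.coe_one]; linarith)), Or.inl (Subtype.ext (by rw [Icc.coe_zero]; linarith))⟩

/-- Polar coordinates on the disk. -/
def polar : C(I × I, Disk 2) where
  toFun p := ⟨(1 - (p.1 : ℝ)) • (circlePt p.2).1, by
    have h : ‖(circlePt p.2).1‖ = 1 := mem_sphere_zero_iff_norm.mp (circlePt p.2).2
    rw [mem_closedBall_zero_iff, norm_smul, h, mul_one, Real.norm_eq_abs,
      abs_of_nonneg (by linarith [p.1.2.2])]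
    linarith [p.1.2.1]⟩
  continuous_toFun := by
    have h1 : Continuous fun p : I × I => 1 - (p.1 : ℝ) := by fun_prop
    have h2 : Continuous fun p : I × I => (p.2 : ℝ) := by fun_prop
    exact (h1.smul (continuous_subtype_val.comp (continuous_circlePt.comp h2))).subtype_mk _

theorem norm_polar (p : I × I) : ‖(polar p).1‖ = 1 - p.1 := by
  have h : ‖(circlePt p.2).1‖ = 1 := mem_sphere_zero_iff_norm.mp (circlePt p.2).2
  change ‖(1 - (p.1 : ℝ)) • (circlePt p.2).1‖ = _
  rw [norm_smul, h, mul_one, Real.norm_eq_abs, abs_of_nonneg (by linarith [p.1.2.2])]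

theorem polar_surjective : Function.Surjective polar := fun d => by
  have hd : ‖d.1‖ ≤ 1 := mem_closedBall_zero_iff.mp d.2
  rcases eq_or_ne d.1 0 with h0 | h0
  · exact ⟨(1, 0), Subtype.ext (by simp [polar, h0])⟩
  · have hn : ‖d.1‖ ≠ 0 := norm_ne_zero_iff.mpr h0
    obtain ⟨t, ht⟩ := exists_circlePt_eq ⟨‖d.1‖⁻¹ • d.1, by
      rw [mem_sphere_zero_iff_norm, norm_smul, norm_inv, norm_norm, inv_mul_cancel₀ hn]⟩
    refine ⟨(⟨1 - ‖d.1‖, by linarith, by linarith [norm_nonneg d.1]⟩, t), Subtype.ext ?_⟩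
    change (1 - (1 - ‖d.1‖)) • (circlePt t).1 = d.1
    rw [ht, sub_sub_cancel, smul_inv_smul₀ hn]

theorem polar_eq {p p' : I × I} (h : polar p = polar p') :
    p.1 = p'.1 ∧ (p.1 = 1 ∨ circlePt p.2 = circlePt p'.2) := by
  have h1 : p.1 = p'.1 := by
    have := norm_polar p
    rw [h, norm_polar] at this
    exact Subtype.ext (by linarith)
  refine ⟨h1, or_iff_not_imp_left.mpr fun hp => Subtype.ext ?_⟩
  have h2 : (1 - (p.1 : ℝ)) • (circlePt p.2).1 = (1 - (p'.1 : ℝ)) • (circlePt p'.2).1 :=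
    congrArg Subtype.val h
  rw [← h1] at h2
  refine smul_right_injective _ (fun h3 => hp (Subtype.ext ?_)) h2
  rw [Icc.coe_one]
  linarith

/-- A map from the circle to a simply connected space extends over the disk. -/
theorem exists_disk_extension {Y : Type*} [TopologicalSpace Y] [SimplyConnectedSpace Y]
    (β : C(Sph 1, Y)) : ∃ G : C(Disk 2, Y), ∀ s : Sph 1, G s.toDisk = β s := by
  let γ : Path (β (circlePt 0)) (β (circlePt 0)) :=
    { toFun := fun t => β (circlePt t)
      continuous_toFun := β.continuous.comp (continuous_circlePt.comp continuous_subtype_val)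
      source' := by simp
      target' := by simp [circlePt_zero_eq_one] }
  -- The null-homotopy is read in polar coordinates: time 0 is the boundary circle and time 1 the
  -- center of the disk.
  obtain ⟨H⟩ := SimplyConnectedSpace.paths_homotopic γ (Path.refl _)
  have hq : IsQuotientMap polar :=
    (polar.continuous.isClosedMap).isQuotientMap polar.continuous polar_surjective
  have hend : ∀ (s t : I), t = 0 ∨ t = 1 → H (s, t) = β (circlePt 0) := by
    rintro s t (rfl | rfl)
    · exact H.source s
    · exact H.target s
  -- `polar` identifies only the edge `s = 1`, where `H` is constant, and the sides `t = 0` and `t =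
  -- 1`, where `H` stays at the base point.
  have hH : ∀ p p', polar p = polar p' → H p = H p' := by
    rintro ⟨s, t⟩ ⟨s', t'⟩ h
    obtain ⟨h1, h2⟩ := polar_eq h
    obtain rfl : s = s' := h1
    rcases h2 with h2 | h2
    · obtain rfl : s = 1 := h2
      exact (H.apply_one t).trans (H.apply_one t').symm
    · rcases circlePt_eq_iff h2 with h3 | h3
      · exact congrArg (fun x => H (s, x)) h3
      · exact (hend s t h3.1).trans (hend s t' h3.2).symm
  refine ⟨hq.lift H.toContinuousMap hH, fun x => ?_⟩
  obtain ⟨t, rfl⟩ := exists_circlePt_eq x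
  have hx : (circlePt t).toDisk = polar (0, t) := Subtype.ext (by simp [polar, Sph.toDisk])
  rw [hx]
  exact (congrArg (fun f => f (0, t)) (hq.lift_comp H.toContinuousMap hH)).trans (H.apply_zero t)

/-! ### Comparison of cellular realizations -/

namespace TwoCells

variable {X : Type u} {Q : Type v} {Z : Type w} [Fintype Q] {C : CSSCode X Q Z} {T : ZLift C}
  {S : OneSkeleton T}

/-- The `2`-skeletons for two choices of `2`-cells are related by a map under the `1`-skeleton. -/
theorem exists_comparison (D D' : TwoCells S) : ∃ F : C(D.Skel2, D'.Skel2),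
    F.comp (Attach.base D.attachAll) = Attach.base D'.attachAll := by
  have h : ∀ p : Σ z, D.Face z, ∃ G : C(Disk 2, D'.Part2 p.1),
      ∀ s : Sph 1, G s.toDisk = Attach.base (D'.attach p.1) (D.attach p.1 p.2 s) := fun p =>
    have := D'.simplyConnected p.1
    exists_disk_extension ((Attach.base (D'.attach p.1)).comp (D.attach p.1 p.2))
  choose G hG using h
  -- The 1-skeleton is kept, and each 2-cell of `D` goes to the disk that fills its boundary in the
  -- part of `D'` belonging to the same check.
  refine ⟨Attach.desc (Attach.base D'.attachAll) (fun p => (D'.incl2 p.1).comp (G p))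
    fun p s => ?_, rfl⟩
  rw [ContinuousMap.comp_apply, hG]
  rfl

/-- The comparison map carries the null-homotopy over and leaves the loop unchanged. A map in each
direction is enough to compare kernels; the two need not be inverse up to homotopy. -/
theorem nullhomotopic_of_nullhomotopic (D D' : TwoCells S) {p : S.graph.Space} (γ : Path p p)
    (h : (γ.map (Attach.base D.attachAll).continuous).Homotopic (Path.refl _)) :
    (γ.map (Attach.base D'.attachAll).continuous).Homotopic (Path.refl _) := by
  obtain ⟨F, hF⟩ := exists_comparison D D'
  rw [← hF]
  exact h.map F

end TwoCells

namespace CellularRealization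

variable {X : Type u} {Q : Type v} {Z : Type w} [Fintype Q] {C : CSSCode X Q Z} {T : ZLift C}
  {S : OneSkeleton T} (L : CellularRealization S)

/-- The inclusion of the `2`-skeleton. -/
def inclSkel2 : C(L.twoCells.Skel2, L.Space) :=
  (Attach.base L.attach5).comp ((Attach.base (L.twoCells.attach4 L.core)).comp
    (Attach.base L.twoCells.attach3))

theorem isPathFull_inclSkel2 : IsPathFull L.inclSkel2 :=
  (Attach.isPathFull_base _ (by norm_num)).comp
    ((Attach.isPathFull_base _ (by norm_num)).comp (Attach.isPathFull_base _ (by norm_num)))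

/-- The remaining cells have dimensions 3, 4 and 5, attached along spheres of dimension at least 2.
-/
theorem isPathFaithful_inclSkel2 : IsPathFaithful L.inclSkel2 :=
  (Attach.isPathFaithful_base _ (by norm_num)).comp
    ((Attach.isPathFaithful_base _ (by norm_num)).comp
      (Attach.isPathFaithful_base _ (by norm_num)))

theorem isPathFull_incl : IsPathFull L.incl :=
  L.isPathFull_inclSkel2.comp (Attach.isPathFull_base _ le_rfl)

theorem nullhomotopic_iff {p : S.graph.Space} (γ : Path p p) :
    (γ.map L.incl.continuous).Homotopic (Path.refl _) ↔
      (γ.map (Attach.base L.twoCells.attachAll).continuous).Homotopic (Path.refl _) :=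
  ⟨fun h => L.isPathFaithful_inclSkel2 _ _ (γ.map (Attach.base L.twoCells.attachAll).continuous)
    (Path.refl _) h, fun h => h.map L.inclSkel2⟩

theorem pathConnectedSpace [PathConnectedSpace S.graph.Space] : PathConnectedSpace L.Space :=
  have := Attach.pathConnectedSpace L.twoCells.attachAll
  have := Attach.pathConnectedSpace L.twoCells.attach3
  have := Attach.pathConnectedSpace (L.twoCells.attach4 L.core)
  Attach.pathConnectedSpace L.attach5

theorem nonempty_fundamentalGroup_mulEquiv (L₁ L₂ : CellularRealization S) (p : S.graph.Space) :
    Nonempty (FundamentalGroup L₁.Space (L₁.incl p) ≃* FundamentalGroup L₂.Space (L₂.incl p)) :=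
  nonempty_mulEquiv_of_nullhomotopic_iff L₁.isPathFull_incl L₂.isPathFull_incl p fun γ =>
    (L₁.nullhomotopic_iff γ).trans
      (Iff.trans ⟨TwoCells.nullhomotopic_of_nullhomotopic _ _ γ,
        TwoCells.nullhomotopic_of_nullhomotopic _ _ γ⟩ (L₂.nullhomotopic_iff γ).symm)

end CellularRealization

end CSSRealization

end

theorem mainTheorem6 {X Q Z : Type*} [Fintype X] [Fintype Q] [Fintype Z]
    (C : CSSRealization.CSSCode X Q Z) (T : CSSRealization.ZLift C)
    (S : CSSRealization.OneSkeleton T) (L₁ L₂ : CSSRealization.CellularRealization S) :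
    (∀ p : S.graph.Space,
      Nonempty (FundamentalGroup L₁.Space (L₁.incl p) ≃*
        FundamentalGroup L₂.Space (L₂.incl p))) ∧
    (PathConnectedSpace S.graph.Space → ∀ (a₁ : L₁.Space) (a₂ : L₂.Space),
      Nonempty (FundamentalGroup L₁.Space a₁ ≃* FundamentalGroup L₂.Space a₂)) := by
  refine ⟨fun p => L₁.nonempty_fundamentalGroup_mulEquiv L₂ p, fun _ a₁ a₂ => ?_⟩
  have := L₁.pathConnectedSpace
  have := L₂.pathConnectedSpace
  -- Path connectedness passes from the 1-skeleton to both realizations, so both base points can be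
  -- moved to the image of one point of the 1-skeleton.
  obtain ⟨p⟩ := PathConnectedSpace.nonempty (X := S.graph.Space)
  obtain ⟨e⟩ := L₁.nonempty_fundamentalGroup_mulEquiv L₂ p
  exact ⟨((FundamentalGroup.fundamentalGroupMulEquivOfPathConnected a₁ (L₁.incl p)).trans e).trans
    (FundamentalGroup.fundamentalGroupMulEquivOfPathConnected (L₂.incl p) a₂)⟩
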